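/- Work in continuous logic over a 1-bounded, one-sorted metric signature $L$ with arbitrary finitary predicate, function and constant symbols, each predicate or function symbol $s$ carrying a modulus of uniform continuity $\Delta_s\colon(0,1]\to(0,1]$. An $L$-structure is a nonempty complete metric space $(M,d)$ with $d\le 1$ in which each constant symbol is interpreted by an element of $M$, each $n$-ary predicate symbol by a map $M^n\to[0,1]$ and each $n$-ary function symbol by a map $M^n\to M$, such that for every symbol $s$ with interpretation $s^M$, every $\epsilon\in(0,1]$ and all tuples $a,b$ from $M$, if $d(a,b)<\Delta_s(\epsilon)$ (maximum metric on tuples) then $s^M(a)$ and $s^M(b)$ are at distance at most $\epsilon$. An almost $L$-structure is defined in the same way, except that for each symbol $s$ this clause is required only for all sufficiently small $\epsilon>0$. Formulas are built from atomic formulas $d(t_1,t_2)$ and $P(t_1,\dots,t_n)$, where the $t_i$ are terms, using all continuous connectives $[0,1]^k\to[0,1]$ and the quantifiers $\sup_x$ and $\inf_x$; sentences are formulas without free variables, and $\sigma^M\in[0,1]$ denotes the value of $\sigma$ in $M$. Let $M$ be an $L$-structure. - $M$ is strongly pseudofinite (respectively almost strongly pseudofinite) if for every $L$-sentence $\sigma$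 with $\sigma^M=0$ there is a finite $L$-structure (respectively a finite almost $L$-structure) $A$ with $\sigma^A=0$. - $M$ is $\omega$-saturated if for every finite set $B\subseteq M$, every $n$ and every set $\Gamma$ of conditions $\varphi(x_1,\dots,x_n)=0$, where the $\varphi$ are $L$-formulas with parameters from $B$, if every finite subset of $\Gamma$ is satisfied by some tuple in $M^n$, then $\Gamma$ is satisfied by some tuple in $M^n$. - A function $f\colon M\to M$ is formula-definable if there are an $L$-formula $\varphi(x,y,z)$, where $z$ is a finite tuple of variables, and a tuple $a$ from $M$ such that $d(f(x),y)=\varphi^M(x,y,a)$ for all $x,y\in M$. **Proposition.** Let $M$ be an $\omega$-saturated $L$-structure and let $f\colon M\to M$ be formula-definable. If $M$ is strongly pseudofinite and $f$ is injective, then $f$ is surjective. The same holds if $M$ is only assumed to be almost strongly pseudofinite. -/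

import Mathlib

universe u v w

/-- A 1-bounded, one-sorted metric signature: function symbols (constant symbols are the
`0`-ary ones) and predicate symbols of each finite arity, and for each symbol a modulus of uniform
continuity, that is, an arbitrary function `(0,1] → (0,1]`. -/
structure MetricSignature extends FirstOrder.Language.{u, v} where
  funModulus : ∀ {n : ℕ}, Functions n → Set.Ioc (0 : ℝ) 1 → Set.Ioc (0 : ℝ) 1
  relModulus : ∀ {n : ℕ}, Relations n → Set.Ioc (0 : ℝ) 1 → Set.Ioc (0 : ℝ) 1

namespace MetricSignature

/-- Formulas of continuous logic with free variables among `x₀, …, xₙ₋₁`. The connectives are all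
the continuous functions `[0,1]ᵏ → [0,1]`; the quantifiers `sup` and `inf` bind the last
variable. -/
inductive Formula (L : MetricSignature.{u, v}) : ℕ → Type (max u v)
  | dist {n : ℕ} (s t : L.toLanguage.Term (Fin n)) : Formula L n
  | rel {n k : ℕ} (R : L.Relations k) (t : Fin k → L.toLanguage.Term (Fin n)) : Formula L n
  | conn {n k : ℕ} (c : C(Fin k → unitInterval, unitInterval)) (φ : Fin k → Formula L n) : Formula L n
  | sup {n : ℕ} (φ : Formula L (n + 1)) : Formula L n
  | inf {n : ℕ} (φ : Formula L (n + 1)) : Formula L n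

/-- A sentence is a formula without free variables. -/
abbrev Sentence (L : MetricSignature.{u, v}) : Type (max u v) := L.Formula 0

/-- An interpretation of the symbols of `L` in a nonempty complete metric space of diameter at
most `1`, with no requirement yet about the moduli of continuity. -/
structure Interpretation (L : MetricSignature.{u, v}) where
  carrier : Type w
  [metricSpace : MetricSpace carrier]
  [nonempty : Nonempty carrier]
  [completeSpace : CompleteSpace carrier]
  dist_le_one : ∀ x y : carrier, dist x y ≤ 1
  funMap : ∀ {n : ℕ}, L.Functions n → (Fin n → carrier) → carrier
  relMap : ∀ {n : ℕ}, L.Relations n → (Fin n → carrier) → unitInterval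

namespace Interpretation

variable {L : MetricSignature.{u, v}}

instance : CoeSort L.Interpretation.{u, v, w} (Type w) := ⟨carrier⟩

attribute [instance] metricSpace nonempty completeSpace

/-- The metric as a function with values in `[0,1]`. -/
def idist (M : L.Interpretation.{u, v, w}) (x y : M) : unitInterval :=
  ⟨dist x y, dist_nonneg, M.dist_le_one x y⟩

/-- The value of a term. -/
def termVal (M : L.Interpretation.{u, v, w}) {n : ℕ} (a : Fin n → M) :
    L.toLanguage.Term (Fin n) → M
  | .var i => a i
  | .func f t => M.funMap f fun i => M.termVal a (t i)

/-- The value of a formula. -/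
noncomputable def val (M : L.Interpretation.{u, v, w}) :
    {n : ℕ} → L.Formula n → (Fin n → M) → unitInterval
  | _, .dist s t, a => M.idist (M.termVal a s) (M.termVal a t)
  | _, .rel R t, a => M.relMap R fun i => M.termVal a (t i)
  | _, .conn c φ, a => c fun i => M.val (φ i) a
  | _, .sup φ, a => ⨆ b : M, M.val φ (Fin.snoc a b)
  | _, .inf φ, a => ⨅ b : M, M.val φ (Fin.snoc a b)

/-- The value of a sentence. -/
noncomputable def sentenceVal (M : L.Interpretation.{u, v, w}) (σ : L.Sentence) : unitInterval :=
  M.val σ Fin.elim0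

/-- `M` is an `L`-structure: every symbol respects its modulus of uniform continuity. The distance
between tuples is the maximum of the distances between their entries. -/
structure IsStructure (M : L.Interpretation.{u, v, w}) : Prop where
  fun_modulus : ∀ {n : ℕ} (f : L.Functions n) (ε : Set.Ioc (0 : ℝ) 1) (a b : Fin n → M),
    dist a b < L.funModulus f ε → dist (M.funMap f a) (M.funMap f b) ≤ ε
  rel_modulus : ∀ {n : ℕ} (R : L.Relations n) (ε : Set.Ioc (0 : ℝ) 1) (a b : Fin n → M),
    dist a b < L.relModulus R ε → |(M.relMap R a : ℝ) - M.relMap R b| ≤ ε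

/-- `M` is an almost `L`-structure: every symbol respects its modulus of uniform continuity for
all sufficiently small `ε`. -/
structure IsAlmostStructure (M : L.Interpretation.{u, v, w}) : Prop where
  fun_modulus : ∀ {n : ℕ} (f : L.Functions n), ∃ ε₀ : ℝ, 0 < ε₀ ∧
    ∀ ε : Set.Ioc (0 : ℝ) 1, (ε : ℝ) < ε₀ → ∀ a b : Fin n → M,
      dist a b < L.funModulus f ε → dist (M.funMap f a) (M.funMap f b) ≤ ε
  rel_modulus : ∀ {n : ℕ} (R : L.Relations n), ∃ ε₀ : ℝ, 0 < ε₀ ∧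
    ∀ ε : Set.Ioc (0 : ℝ) 1, (ε : ℝ) < ε₀ → ∀ a b : Fin n → M,
      dist a b < L.relModulus R ε → |(M.relMap R a : ℝ) - M.relMap R b| ≤ ε

/-- `M` is strongly pseudofinite: every sentence with value `0` in `M` has value `0` in some finite
`L`-structure. -/
def StronglyPseudofinite (M : L.Interpretation.{u, v, w}) : Prop :=
  ∀ σ : L.Sentence, M.sentenceVal σ = 0 →
    ∃ A : L.Interpretation.{u, v, w}, A.IsStructure ∧ Finite A ∧ A.sentenceVal σ = 0

/-- `M` is almost strongly pseudofinite: every sentence with value `0` in `M` has value `0` in some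
finite almost `L`-structure. -/
def AlmostStronglyPseudofinite (M : L.Interpretation.{u, v, w}) : Prop :=
  ∀ σ : L.Sentence, M.sentenceVal σ = 0 →
    ∃ A : L.Interpretation.{u, v, w}, A.IsAlmostStructure ∧ Finite A ∧ A.sentenceVal σ = 0

/-- `M` is `ω`-saturated: for all finite tuples `a` of parameters and all sets `Γ` of conditions
`φ(a, x) = 0` in a finite tuple `x` of variables, if every finite subset of `Γ` is satisfied by some
tuple of `M`, then so is `Γ`. -/
def OmegaSaturated (M : L.Interpretation.{u, v, w}) : Prop :=
  ∀ (m : ℕ) (a : Fin m → M) (n : ℕ) (Γ : Set (L.Formula (m + n))),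
    (∀ Δ : Set (L.Formula (m + n)), Δ ⊆ Γ → Δ.Finite →
      ∃ b : Fin n → M, ∀ φ ∈ Δ, M.val φ (Fin.append a b) = 0) →
    ∃ b : Fin n → M, ∀ φ ∈ Γ, M.val φ (Fin.append a b) = 0

/-- `f` is formula-definable: `d(f(x), y) = φ(x, y, a)` for some formula `φ` and some finite tuple
`a` of parameters. -/
def FormulaDefinable (M : L.Interpretation.{u, v, w}) (f : M → M) : Prop :=
  ∃ (k : ℕ) (φ : L.Formula (2 + k)) (a : Fin k → M),
    ∀ x y : M, dist (f x) y = (M.val φ (Fin.append ![x, y] a) : ℝ)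

end Interpretation

end MetricSignature

namespace MetricSignature

namespace Formula

variable {L : MetricSignature.{u, v}}

/-! An implication between conditions, such as injectivity of `f`, is not itself a condition of
continuous logic. In a saturated `M`, however, the joint values of finitely many formulas form a
closed set (`OmegaSaturated.isClosed_range_val`), and the distance to that set is a continuous
connective. One condition therefore forces every value pattern of another interpretation to occur
exactly in `M` (`OmegaSaturated.exists_formula`). Suppose `f` misses `y₀`. Pass to a finite `A` with
such a condition for suitable formulas, where `z` plays the role of `y₀`. The zeros of `φ` in `A`
contain the graph of a total function, injective because `f` is, hence surjective by finiteness. A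
preimage of `z` transfers back to a preimage of `y₀`. -/

/-- Extend a renaming of variables by fixing one further, last variable. -/
def liftVar {n m : ℕ} (g : Fin n → Fin m) : Fin (n + 1) → Fin (m + 1) :=
  Fin.snoc (fun i => (g i).castSucc) (Fin.last m)

/-- Rename the free variables of a formula. -/
def rename : {n m : ℕ} → (Fin n → Fin m) → L.Formula n → L.Formula m
  | _, _, g, .dist s t => .dist (s.relabel g) (t.relabel g)
  | _, _, g, .rel R t => .rel R fun i => (t i).relabel g
  | _, _, g, .conn c φ => .conn c fun i => (φ i).rename g
  | _, _, g, .sup φ => .sup (φ.rename (liftVar g))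
  | _, _, g, .inf φ => .inf (φ.rename (liftVar g))

/-- Take the supremum over the last `n` variables. -/
def supLast {N : ℕ} : (n : ℕ) → L.Formula (N + n) → L.Formula N
  | 0, φ => φ
  | n + 1, φ => supLast n (.sup φ)

/-- Take the infimum over the last `n` variables. -/
def infLast {N : ℕ} : (n : ℕ) → L.Formula (N + n) → L.Formula N
  | 0, φ => φ
  | n + 1, φ => infLast n (.inf φ)

end Formula

namespace Interpretation

open Formula

variable {L : MetricSignature.{u, v}} (M : L.Interpretation.{u, v, w})

/-! ### Semantics of renaming and of quantifier blocks -/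

theorem termVal_relabel {n m : ℕ} (g : Fin n → Fin m) (a : Fin m → M)
    (t : L.toLanguage.Term (Fin n)) :
    M.termVal a (t.relabel g) = M.termVal (a ∘ g) t := by
  induction t with
  | var i => rfl
  | func f t ih =>
    simp only [FirstOrder.Language.Term.relabel, termVal]
    exact congrArg _ (funext ih)

theorem snoc_comp_liftVar {α : Type*} {n m : ℕ} (g : Fin n → Fin m) (a : Fin m → α) (b : α) :
    (Fin.snoc a b : Fin (m + 1) → α) ∘ liftVar g = Fin.snoc (a ∘ g) b := by
  funext i
  refine Fin.lastCases ?_ (fun i => ?_) i <;> simp [liftVar]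

theorem val_rename {n m : ℕ} (φ : L.Formula n) (g : Fin n → Fin m) (a : Fin m → M) :
    M.val (φ.rename g) a = M.val φ (a ∘ g) := by
  induction φ generalizing m with
  | dist s t => simp only [rename, val, termVal_relabel]
  | rel R t => simp only [rename, val, termVal_relabel]
  | conn c φ ih => simp only [rename, val, ih]
  | sup φ ih => simp only [rename, val, ih, snoc_comp_liftVar]
  | inf φ ih => simp only [rename, val, ih, snoc_comp_liftVar]

theorem val_sup_eq_zero {n : ℕ} (φ : L.Formula (n + 1)) (a : Fin n → M) :
    M.val (.sup φ) a = 0 ↔ ∀ b : M, M.val φ (Fin.snoc a b) = 0 :=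
  iSup_eq_bot

theorem val_inf_eq_zero_of_exists {n : ℕ} {φ : L.Formula (n + 1)} {a : Fin n → M}
    (h : ∃ b : M, M.val φ (Fin.snoc a b) = 0) : M.val (.inf φ) a = 0 := by
  obtain ⟨b, hb⟩ := h
  exact le_bot_iff.1 ((iInf_le (fun b : M => M.val φ (Fin.snoc a b)) b).trans hb.le)

/-- Infima over a finite set are attained, so finite models supply exact witnesses. -/
theorem exists_of_val_inf_eq_zero [Finite M] {n : ℕ} {φ : L.Formula (n + 1)} {a : Fin n → M}
    (h : M.val (.inf φ) a = 0) : ∃ b : M, M.val φ (Fin.snoc a b) = 0 := by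
  obtain ⟨b, hb⟩ := exists_eq_ciInf_of_finite (f := fun b : M => M.val φ (Fin.snoc a b))
  exact ⟨b, hb.trans h⟩

theorem val_supLast_eq_zero {N n : ℕ} (φ : L.Formula (N + n)) (a : Fin N → M) :
    M.val (φ.supLast n) a = 0 ↔ ∀ b : Fin n → M, M.val φ (Fin.append a b) = 0 := by
  induction n with
  | zero =>
    have h (b : Fin 0 → M) : Fin.append a b = a := by
      rw [Subsingleton.elim b Fin.elim0, Fin.append_elim0]; rfl
    simp only [h, supLast, forall_const]
  | succ n ih =>
    simp only [supLast]
    rw [ih]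
    constructor
    · intro h b
      have := (M.val_sup_eq_zero φ _).1 (h (Fin.init b)) (b (Fin.last n))
      rwa [← Fin.append_snoc, Fin.snoc_init_self] at this
    · intro h b
      refine (M.val_sup_eq_zero φ _).2 fun c => ?_
      rw [← Fin.append_snoc]
      exact h _

theorem val_infLast_eq_zero_of_exists {N n : ℕ} {φ : L.Formula (N + n)} {a : Fin N → M}
    (b : Fin n → M) (h : M.val φ (Fin.append a b) = 0) : M.val (φ.infLast n) a = 0 := by
  induction n with
  | zero =>
    rwa [Subsingleton.elim b Fin.elim0, Fin.append_elim0] at h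
  | succ n ih =>
    refine ih (Fin.init b) (M.val_inf_eq_zero_of_exists ⟨b (Fin.last n), ?_⟩)
    rwa [← Fin.append_snoc, Fin.snoc_init_self]

theorem exists_of_val_infLast_eq_zero [Finite M] {N n : ℕ} {φ : L.Formula (N + n)}
    {a : Fin N → M} (h : M.val (φ.infLast n) a = 0) :
    ∃ b : Fin n → M, M.val φ (Fin.append a b) = 0 := by
  induction n with
  | zero =>
    refine ⟨Fin.elim0, ?_⟩
    rw [Fin.append_elim0]
    exact h
  | succ n ih =>
    obtain ⟨b, hb⟩ := ih h
    obtain ⟨c, hc⟩ := M.exists_of_val_inf_eq_zero hb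
    exact ⟨Fin.snoc b c, by rwa [Fin.append_snoc]⟩

/-! ### Saturation and joint values of formulas -/

/-- The truncation to `[0,1]` of a continuous real function, as a connective. -/
noncomputable def truncConn {k : ℕ} (g : (Fin k → unitInterval) → ℝ) (hg : Continuous g) :
    C(Fin k → unitInterval, unitInterval) :=
  ⟨fun p => Set.projIcc 0 1 zero_le_one (g p), continuous_projIcc.comp hg⟩

theorem truncConn_eq_zero {k : ℕ} {g : (Fin k → unitInterval) → ℝ} {hg : Continuous g}
    {p : Fin k → unitInterval} : truncConn g hg p = 0 ↔ g p ≤ 0 :=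
  Set.projIcc_eq_left zero_lt_one

/-- The values that finitely many formulas take jointly, as the last `n` variables range over a
saturated interpretation, form a closed set. -/
theorem OmegaSaturated.isClosed_range_val {M : L.Interpretation.{u, v, w}}
    (hsat : M.OmegaSaturated) {N n j : ℕ} (ψ : Fin j → L.Formula (N + n)) (a : Fin N → M) :
    IsClosed (Set.range fun (b : Fin n → M) i => M.val (ψ i) (Fin.append a b)) := by
  refine isClosed_of_closure_subset fun p hp => ?_
  have hc (ε : ℝ) : Continuous fun q : Fin j → unitInterval => dist p q - ε := by fun_prop
  let θ (ε : ℝ) : L.Formula (N + n) := .conn (truncConn _ (hc ε)) ψ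
  have hθ (ε : ℝ) (b : Fin n → M) : M.val (θ ε) (Fin.append a b) = 0 ↔
      dist p (fun i => M.val (ψ i) (Fin.append a b)) ≤ ε :=
    truncConn_eq_zero.trans sub_nonpos
  -- Finitely many of these conditions follow from the one with the least `ε`, which is satisfiable
  -- because `p` lies in the closure.
  obtain ⟨b, hb⟩ := hsat N a n (θ '' Set.Ioi 0) fun Δ hΔ hfin => by
    obtain ⟨s, hs, hsfin, rfl⟩ := (Set.exists_subset_image_finite_and (p := (· = Δ))).1
      ⟨Δ, hΔ, hfin, rfl⟩
    obtain ⟨ε, hε, hεs⟩ : ∃ ε > 0, ∀ r ∈ s, ε ≤ r := by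
      rcases s.eq_empty_or_nonempty with rfl | hne
      · exact ⟨1, one_pos, by simp⟩
      · obtain ⟨r, hr, hmin⟩ := Set.exists_min_image s id hsfin hne
        exact ⟨r, hs hr, hmin⟩
    obtain ⟨_, ⟨b, rfl⟩, hb⟩ := Metric.mem_closure_iff.1 hp ε hε
    refine ⟨b, ?_⟩
    rintro _ ⟨r, hr, rfl⟩
    exact (hθ r b).2 (hb.le.trans (hεs r hr))
  refine ⟨b, (dist_le_zero.1 (le_of_forall_pos_le_add fun ε hε => ?_)).symm⟩
  rw [zero_add]
  exact (hθ ε b).1 (hb _ ⟨ε, hε, rfl⟩)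

/-- In a saturated `M`, a single condition on the parameters `a`, satisfied in `M`, ensures in every
interpretation that the joint values of given formulas are among those taken in `M`. -/
theorem OmegaSaturated.exists_formula {M : L.Interpretation.{u, v, w}}
    (hsat : M.OmegaSaturated) {N n j : ℕ} (ψ : Fin j → L.Formula (N + n)) (a : Fin N → M) :
    ∃ θ : L.Formula N, M.val θ a = 0 ∧
      ∀ (A : L.Interpretation.{u, v, w}) (c : Fin N → A), A.val θ c = 0 → ∀ b : Fin n → A,
        ∃ b' : Fin n → M, ∀ i, M.val (ψ i) (Fin.append a b') = A.val (ψ i) (Fin.append c b) := by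
  have hcl := hsat.isClosed_range_val ψ a
  -- `Metric.infDist` to the empty set is `0`, so membership needs a nonempty range.
  have hne := Set.range_nonempty fun (b : Fin n → M) i => M.val (ψ i) (Fin.append a b)
  refine ⟨supLast n (.conn (truncConn _ (Metric.continuous_infDist_pt
    (Set.range fun (b : Fin n → M) i => M.val (ψ i) (Fin.append a b)))) ψ), ?_, ?_⟩
  · exact (M.val_supLast_eq_zero _ _).2 fun b =>
      truncConn_eq_zero.2 (Metric.infDist_zero_of_mem (Set.mem_range_self b)).le
  · intro A c h b
    have hb : Metric.infDist (fun i => A.val (ψ i) (Fin.append c b)) _ ≤ 0 :=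
      truncConn_eq_zero.1 ((A.val_supLast_eq_zero _ _).1 h b)
    obtain ⟨b', hb'⟩ := (hcl.mem_iff_infDist_zero hne).2
      (le_antisymm hb Metric.infDist_nonneg)
    exact ⟨b', congrFun hb'⟩

/-! ### Transfer to a finite interpretation -/

theorem IsStructure.isAlmostStructure {M : L.Interpretation.{u, v, w}} (h : M.IsStructure) :
    M.IsAlmostStructure :=
  ⟨fun f => ⟨1, one_pos, fun ε _ => h.fun_modulus f ε⟩,
    fun R => ⟨1, one_pos, fun ε _ => h.rel_modulus R ε⟩⟩

theorem StronglyPseudofinite.almost {M : L.Interpretation.{u, v, w}}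
    (h : M.StronglyPseudofinite) : M.AlmostStronglyPseudofinite := fun σ hσ =>
  let ⟨A, hA, hfin, hval⟩ := h σ hσ
  ⟨A, hA.isAlmostStructure, hfin, hval⟩

theorem comp_append {α β : Type*} {m n : ℕ} (g : α → β) (p : Fin m → α) (q : Fin n → α) :
    g ∘ Fin.append p q = Fin.append (g ∘ p) (g ∘ q) := by
  funext i
  refine Fin.addCases (fun i => ?_) (fun i => ?_) i <;> simp

theorem surjective_of_injective {M : L.Interpretation.{u, v, w}} (hsat : M.OmegaSaturated)
    (hfin : M.AlmostStronglyPseudofinite) {f : M → M} (hf : M.FormulaDefinable f)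
    (hinj : Function.Injective f) : Function.Surjective f := by
  intro y₀
  by_contra hy₀
  obtain ⟨k, φ, a, hφ⟩ := hf
  have hφ0 (x y : M) : M.val φ (Fin.append ![x, y] a) = 0 ↔ f x = y := by
    rw [← dist_eq_zero (x := f x), hφ]
    exact Subtype.ext_iff
  -- The variables are the parameters `a`, the point `y₀`, and then `x`, `x'`, `y`.
  let q (i : Fin k) : Fin (0 + (k + 1) + 3) := Fin.castAdd 3 (Fin.natAdd 0 i.castSucc)
  let q₀ : Fin (0 + (k + 1) + 3) := Fin.castAdd 3 (Fin.natAdd 0 (Fin.last k))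
  let x (i : Fin 3) : Fin (0 + (k + 1) + 3) := Fin.natAdd _ i
  -- Formulas 0, 1, 2 carry injectivity, 3 the omission of `y₀`, and 4 the totality of `f`.
  let ψ : Fin 5 → L.Formula (0 + (k + 1) + 3) :=
    ![.dist (.var (x 0)) (.var (x 1)),
      φ.rename (Fin.append ![x 0, x 2] q),
      φ.rename (Fin.append ![x 1, x 2] q),
      φ.rename (Fin.append ![x 0, q₀] q),
      .inf (φ.rename (Fin.append ![(x 0).castSucc, Fin.last _] (Fin.castSucc ∘ q)))]
  have hψ (A : L.Interpretation.{u, v, w}) (c : Fin k → A) (z : A) (b : Fin 3 → A) :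
      ∀ e, e = Fin.append (Fin.append Fin.elim0 (Fin.snoc c z : Fin (k + 1) → A)) b →
      A.val (ψ 0) e = A.idist (b 0) (b 1) ∧
      A.val (ψ 1) e = A.val φ (Fin.append ![b 0, b 2] c) ∧
      A.val (ψ 2) e = A.val φ (Fin.append ![b 1, b 2] c) ∧
      A.val (ψ 3) e = A.val φ (Fin.append ![b 0, z] c) ∧
      A.val (ψ 4) e = ⨅ y : A, A.val φ (Fin.append ![b 0, y] c) := by
    intro e he
    have hx (i : Fin 3) : e (x i) = b i := by rw [he, Fin.append_right]
    have hq₀ : e q₀ = z := by rw [he, Fin.append_left, Fin.append_right, Fin.snoc_last]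
    have hq (i : Fin k) : e (q i) = c i := by
      rw [he, Fin.append_left, Fin.append_right, Fin.snoc_castSucc]
    clear_value q q₀ x
    refine ⟨?_, ?_, ?_, ?_, ?_⟩
    · simp [ψ, val, termVal, hx]
    · refine (A.val_rename _ _ _).trans (congrArg _ ?_)
      rw [comp_append]
      refine congrArg₂ _ (funext fun i => ?_) (funext fun i => ?_)
      · fin_cases i <;> simp [hx]
      · simp [hq]
    · refine (A.val_rename _ _ _).trans (congrArg _ ?_)
      rw [comp_append]
      refine congrArg₂ _ (funext fun i => ?_) (funext fun i => ?_)
      · fin_cases i <;> simp [hx]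
      · simp [hq]
    · refine (A.val_rename _ _ _).trans (congrArg _ ?_)
      rw [comp_append]
      refine congrArg₂ _ (funext fun i => ?_) (funext fun i => ?_)
      · fin_cases i <;> simp [hx, hq₀]
      · simp [hq]
    · refine iInf_congr fun y => (A.val_rename _ _ _).trans (congrArg _ ?_)
      rw [comp_append]
      refine congrArg₂ _ (funext fun i => ?_) (funext fun i => ?_)
      · fin_cases i <;> simp [hx]
      · simp [hq]
  obtain ⟨θ, hθM, hθ⟩ := hsat.exists_formula ψ (Fin.append Fin.elim0 (Fin.snoc a y₀))
  -- Binding `a` and `y₀` by infima gives a sentence; finiteness of `A` then returns actual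
  -- parameters `c` and `z`.
  obtain ⟨A, -, hA, hσ⟩ := hfin (θ.infLast (k + 1)) (M.val_infLast_eq_zero_of_exists _ hθM)
  obtain ⟨c', hc'⟩ := A.exists_of_val_infLast_eq_zero hσ
  obtain ⟨c, z, rfl⟩ : ∃ c z, c' = Fin.snoc c z := ⟨_, _, (Fin.snoc_init_self c').symm⟩
  have key (x x' y : A) : ∃ u u' t : M,
      M.idist u u' = A.idist x x' ∧
      M.val φ (Fin.append ![u, t] a) = A.val φ (Fin.append ![x, y] c) ∧
      M.val φ (Fin.append ![u', t] a) = A.val φ (Fin.append ![x', y] c) ∧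
      M.val φ (Fin.append ![u, y₀] a) = A.val φ (Fin.append ![x, z] c) ∧
      ⨅ t : M, M.val φ (Fin.append ![u, t] a) = ⨅ y : A, A.val φ (Fin.append ![x, y] c) := by
    obtain ⟨b, hb⟩ := hθ A _ hc' ![x, x', y]
    obtain ⟨h0, h1, h2, h3, h4⟩ := hψ M a y₀ b _ rfl
    obtain ⟨g0, g1, g2, g3, g4⟩ := hψ A c z ![x, x', y] _ rfl
    exact ⟨b 0, b 1, b 2, h0.symm.trans ((hb 0).trans g0), h1.symm.trans ((hb 1).trans g1),
      h2.symm.trans ((hb 2).trans g2), h3.symm.trans ((hb 3).trans g3),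
      h4.symm.trans ((hb 4).trans g4)⟩
  have htot (x : A) : ∃ y : A, A.val φ (Fin.append ![x, y] c) = 0 := by
    obtain ⟨u, -, -, -, -, -, -, h⟩ := key x x x
    obtain ⟨y, hy⟩ := exists_eq_ciInf_of_finite (f := fun y : A => A.val φ (Fin.append ![x, y] c))
    refine ⟨y, hy.trans (h.symm.trans (le_bot_iff.1 ?_))⟩
    exact (iInf_le _ (f u)).trans ((hφ0 u (f u)).2 rfl).le
  choose g hg using htot
  -- If `g x = g x'`, the copies `u`, `u'` in `M` have the same image `t` under `f`, so they
  -- coincide, and their distance is that of `x` and `x'`.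
  have hginj : Function.Injective g := by
    intro x x' hxx'
    obtain ⟨u, u', t, hd, h, h', -⟩ := key x x' (g x)
    have hu := (hφ0 u t).1 (h.trans (hg x))
    have hu' := (hφ0 u' t).1 (h'.trans (hxx' ▸ hg x'))
    have : dist u u' = dist x x' := congrArg Subtype.val hd
    rw [hinj (hu.trans hu'.symm), dist_self] at this
    exact dist_eq_zero.1 this.symm
  obtain ⟨x, hx⟩ := (Finite.injective_iff_surjective.1 hginj) z
  obtain ⟨u, -, -, -, -, -, h, -⟩ := key x x x
  exact hy₀ ⟨u, (hφ0 u y₀).1 (h.trans (hx ▸ hg x))⟩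

end Interpretation

end MetricSignature

theorem mainTheorem4 {L : MetricSignature.{u, v}} (M : L.Interpretation.{u, v, w})
    (hM : M.IsStructure) (hsat : M.OmegaSaturated) (f : M → M) (hf : M.FormulaDefinable f) :
    (M.StronglyPseudofinite → Function.Injective f → Function.Surjective f) ∧
      (M.AlmostStronglyPseudofinite → Function.Injective f → Function.Surjective f) :=
  ⟨fun h => MetricSignature.Interpretation.surjective_of_injective hsat h.almost hf,
    fun h => MetricSignature.Interpretation.surjective_of_injective hsat h hf⟩
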